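/- **Theorem.** Let $n\in\mathbb N$ and let $\mathscr H=\ell^2(\mathbb Z^2)\otimes\mathbb C^n$. Let $H=(H_{ij})_{i,j\in\mathbb Z^2}$, $H_{ij}\in M_n(\mathbb C)$, be a bounded self-adjoint operator on $\mathscr H$ with rapidly decaying matrix coefficients, i.e. $$\sup_{i,j\in\mathbb Z^2}\|H_{ij}\|\cdot d(i,j)^\mu<\infty\qquad\text{for every real }\mu\ge 0,$$ where $d$ is the Euclidean distance (and $0^0=1$). Let $E\in\mathbb R$, let $(a,b)\ni E$ be an open interval disjoint from the spectrum of $H$, and let $\varphi:\mathbb R\to\mathbb R$ be a continuous function with integral one and compact support contained in $(a,b)$. Let $$Y=\{(x,y)\in\mathbb Z^2\mid x\ge 0\},\qquad W=\{(x,y)\in\mathbb Z^2\mid y\ge 0\},$$ let $\chi_Y,\chi_W$ be the operators of multiplication by their indicator functions on $\mathscr H$, and put $\tilde H=\chi_Y H\chi_Y$. Then the operator $$\varphi(\tilde H)\cdot i[\tilde H,\chi_W]$$ on $\mathscr H$, with $\varphi(\tilde H)$ formed by continuous functional calculus, is trace class; i.e. for $T=\varphi(\tilde H)\cdot i[\tilde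 H,\chi_W]$ and every orthonormal basis $(e_k)$ of $\mathscr H$ one has $\sum_k\langle e_k,(T^*T)^{1/2}e_k\rangle<\infty$. -/

import Mathlib

open scoped ENNReal InnerProductSpace

noncomputable section

namespace EdgeTrace

universe u

/-- The Hilbert space `ℓ²(ℤ²) ⊗ ℂⁿ`, realised as the space of square-summable functions
`ℤ² → ℂⁿ`, with the structure of Mathlib's `lp`. -/
def LatticeSpace (n : ℕ) : Type :=
  lp (fun _ : ℤ × ℤ => EuclideanSpace ℂ (Fin n)) 2

instance (n : ℕ) : NormedAddCommGroup (LatticeSpace n) :=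
  inferInstanceAs (NormedAddCommGroup (lp (fun _ : ℤ × ℤ => EuclideanSpace ℂ (Fin n)) 2))

instance (n : ℕ) : InnerProductSpace ℂ (LatticeSpace n) :=
  inferInstanceAs (InnerProductSpace ℂ (lp (fun _ : ℤ × ℤ => EuclideanSpace ℂ (Fin n)) 2))

instance (n : ℕ) : CompleteSpace (LatticeSpace n) :=
  inferInstanceAs (CompleteSpace (lp (fun _ : ℤ × ℤ => EuclideanSpace ℂ (Fin n)) 2))

/-- The value `ψ(i) ∈ ℂⁿ` of a vector `ψ` at the site `i`, as a linear map in `ψ`. -/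
def eval {n : ℕ} (i : ℤ × ℤ) : LatticeSpace n →L[ℂ] EuclideanSpace ℂ (Fin n) :=
  lp.evalCLM ℂ (fun _ : ℤ × ℤ => EuclideanSpace ℂ (Fin n)) 2 i

/-- The vector `δ_j ⊗ v`, as a linear map in `v`. -/
def delta {n : ℕ} (j : ℤ × ℤ) : EuclideanSpace ℂ (Fin n) →L[ℂ] LatticeSpace n :=
  lp.singleContinuousLinearMap ℂ (fun _ : ℤ × ℤ => EuclideanSpace ℂ (Fin n)) 2 j

/-- The Euclidean distance on `ℤ² ⊂ ℝ²`. -/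
def latticeDist (i j : ℤ × ℤ) : ℝ :=
  √(((i.1 : ℝ) - j.1) ^ 2 + ((i.2 : ℝ) - j.2) ^ 2)

/-- Multiplication by the indicator function of `S ⊆ ℤ²`, on vectors. -/
def restrict {n : ℕ} (S : Set (ℤ × ℤ)) (ψ : LatticeSpace n) : LatticeSpace n :=
  ⟨S.indicator (fun i => eval i ψ), by
    have h : Memℓp (fun i => eval i ψ) 2 := ψ.2
    exact h.mono' (fun i => norm_indicator_le_norm_self (fun i => eval i ψ) i)⟩

theorem eval_restrict {n : ℕ} (S : Set (ℤ × ℤ)) (ψ : LatticeSpace n) (i : ℤ × ℤ) :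
    eval i (restrict S ψ) = S.indicator (fun i => eval i ψ) i := rfl

theorem ext_eval {n : ℕ} {ψ η : LatticeSpace n} (h : ∀ i, eval i ψ = eval i η) : ψ = η :=
  Subtype.ext (funext h)

theorem norm_restrict_le {n : ℕ} (S : Set (ℤ × ℤ)) (ψ : LatticeSpace n) :
    ‖restrict S ψ‖ ≤ ‖ψ‖ :=
  lp.norm_mono (E := fun _ : ℤ × ℤ => EuclideanSpace ℂ (Fin n)) (p := 2) (by norm_num)
    (fun i => norm_indicator_le_norm_self (fun i => eval i ψ) i)

/-- The operator `χ_S` of multiplication by the indicator function of `S ⊆ ℤ²`. -/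
def chi {n : ℕ} (S : Set (ℤ × ℤ)) : LatticeSpace n →L[ℂ] LatticeSpace n :=
  LinearMap.mkContinuous
    { toFun := restrict S
      map_add' := fun ψ η => ext_eval fun i => by
        by_cases hi : i ∈ S <;> simp [eval_restrict, hi]
      map_smul' := fun c ψ => ext_eval fun i => by
        by_cases hi : i ∈ S <;> simp [eval_restrict, hi] }
    1 (fun ψ => by
      rw [one_mul]
      exact norm_restrict_le S ψ)

/-- The matrix coefficient `T_{ij} : ℂⁿ → ℂⁿ` of an operator `T` on `ℓ²(ℤ²) ⊗ ℂⁿ`,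
that is `T_{ij} v = (T (δ_j ⊗ v))(i)`. -/
def coeff {n : ℕ} (T : LatticeSpace n →L[ℂ] LatticeSpace n) (i j : ℤ × ℤ) :
    EuclideanSpace ℂ (Fin n) →L[ℂ] EuclideanSpace ℂ (Fin n) :=
  eval i ∘L T ∘L delta j

/-- Rapid decay of matrix coefficients: `sup_{i,j} ‖T_{ij}‖ d(i,j)^μ < ∞` for every real
`μ ≥ 0` (with `0 ^ 0 = 1`). -/
def RapidDecay {n : ℕ} (T : LatticeSpace n →L[ℂ] LatticeSpace n) : Prop :=
  ∀ μ : ℝ, 0 ≤ μ →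
    BddAbove (Set.range fun p : (ℤ × ℤ) × (ℤ × ℤ) =>
      ‖coeff T p.1 p.2‖ * latticeDist p.1 p.2 ^ μ)

/-- The half space `Y = {(x, y) | x ≥ 0}`. -/
def halfY : Set (ℤ × ℤ) := {p | 0 ≤ p.1}

/-- The half space `W = {(x, y) | y ≥ 0}`. -/
def halfW : Set (ℤ × ℤ) := {p | 0 ≤ p.2}

/-- The contraction `χ_Y T χ_Y` of an operator to `Y`. -/
def contraction {n : ℕ} (Y : Set (ℤ × ℤ)) (T : LatticeSpace n →L[ℂ] LatticeSpace n) :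
    LatticeSpace n →L[ℂ] LatticeSpace n :=
  chi Y * T * chi Y

/-- A bounded operator `T` on a Hilbert space is trace class if `∑_k ⟨e_k, |T| e_k⟩ < ∞` for
every orthonormal basis `(e_k)`, where `|T| = (T* T)^{1/2}`. -/
def IsTraceClass {E : Type u} [NormedAddCommGroup E] [InnerProductSpace ℂ E] [CompleteSpace E]
    (T : E →L[ℂ] E) : Prop :=
  ∀ (ι : Type u) (e : HilbertBasis ι ℂ E),
    Summable fun k : ι => (⟪e k, CFC.abs T (e k)⟫_ℂ).re

end EdgeTrace

end

open scoped BoundedContinuousFunction NNReal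

/-!
Put `P = χ_Y`, `G = P H P`, and let `w = 1 + (κ f)²`, where `f` is the distance to the boundary of
`Y`, truncated so that `w` is bounded. Rapid decay bounds `w⁻¹ H w - H` by a multiple of `κ`, and it
bounds `P H (1 - P) w`, both uniformly in the truncation. Let `z` be the centre of the gap and `r`
its radius. For small `κ` the conjugate `w⁻¹ (H - z) w` is therefore invertible with an inverse of
norm close to `r⁻¹`, and multiplying it out gives `P w = K + (G - z) (P w) B`, with `K` bounded and
`‖B‖` close to `r⁻¹`. To the right of `φ(G)` the factor `G - z` may be replaced by an operator of
norm at most some `r' < r`, because `φ` has compact support in the gap; so the last term can be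
absorbed, and `φ(G) P w` is bounded.

Likewise `w⁻¹ [G, χ_W] w v` is bounded for `v = 1 + g²`, where `g` is the truncated distance to the
boundary of `W`. Removing the truncations gives `‖φ(G) [G, χ_W] δ_j‖ ≤ C / ((1 + f_j²) (1 + g_j²))`,
which is summable over the lattice, and an operator `T` with `∑ ‖T e_k‖ < ∞` for a single
orthonormal basis is trace class.
-/

namespace EdgeTrace

universe u

section TraceClass

theorem tsum_enorm_sq_lp {ι : Type*} {F : ι → Type*} [∀ i, NormedAddCommGroup (F i)]
    (f : lp F 2) : ∑' i, ‖f i‖ₑ ^ 2 = ‖f‖ₑ ^ 2 := by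
  have hf : HasSum (fun i => ‖f i‖ ^ 2) (‖f‖ ^ 2) := by
    simpa only [ENNReal.toReal_ofNat, Real.rpow_ofNat] using lp.hasSum_norm (by norm_num) f
  simp_rw [← ofReal_norm, ← ENNReal.ofReal_pow (norm_nonneg _)]
  rw [← hf.tsum_eq, ENNReal.ofReal_tsum_of_nonneg (fun _ => sq_nonneg _) hf.summable]

theorem tsum_enorm_inner_sq {E : Type*} [NormedAddCommGroup E] [InnerProductSpace ℂ E]
    {ι : Type*} (e : HilbertBasis ι ℂ E) (x : E) :
    ∑' i, ‖⟪e i, x⟫_ℂ‖ₑ ^ 2 = ‖x‖ₑ ^ 2 := by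
  simp_rw [← e.repr_apply_apply, tsum_enorm_sq_lp, ← ofReal_norm, e.repr.norm_map]

variable {E : Type u} [NormedAddCommGroup E] [InnerProductSpace ℂ E] [CompleteSpace E]

theorem tsum_enorm_apply_sq_eq_adjoint {F : Type*} [NormedAddCommGroup F] [InnerProductSpace ℂ F]
    [CompleteSpace F] {ι κ : Type*} (e : HilbertBasis ι ℂ E) (f : HilbertBasis κ ℂ F)
    (S : E →L[ℂ] F) :
    ∑' i, ‖S (e i)‖ₑ ^ 2 = ∑' j, ‖S.adjoint (f j)‖ₑ ^ 2 := by
  have inner_swap : ∀ i j, ‖⟪f j, S (e i)⟫_ℂ‖ₑ = ‖⟪e i, S.adjoint (f j)⟫_ℂ‖ₑ := fun i j => by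
    rw [← S.adjoint_inner_left, enorm_eq_iff_norm_eq, norm_inner_symm]
  calc ∑' i, ‖S (e i)‖ₑ ^ 2 = ∑' i, ∑' j, ‖⟪f j, S (e i)⟫_ℂ‖ₑ ^ 2 := by
        simp_rw [tsum_enorm_inner_sq f]
    _ = ∑' j, ∑' i, ‖⟪e i, S.adjoint (f j)⟫_ℂ‖ₑ ^ 2 := by
        rw [ENNReal.tsum_comm]
        simp_rw [inner_swap]
    _ = ∑' j, ‖S.adjoint (f j)‖ₑ ^ 2 := by simp_rw [tsum_enorm_inner_sq e]

theorem re_inner_mul_self_apply {S : E →L[ℂ] E} (hS : IsSelfAdjoint S) (x : E) :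
    (⟪x, (S * S) x⟫_ℂ).re = ‖S x‖ ^ 2 := by
  have h : ⟪x, S (S x)⟫_ℂ = ⟪S x, S x⟫_ℂ := (hS.isSymmetric x (S x)).symm
  exact (congrArg Complex.re h).trans (inner_self_eq_norm_sq (𝕜 := ℂ) (S x))

theorem norm_cfcAbs_apply (T : E →L[ℂ] E) (x : E) : ‖CFC.abs T x‖ = ‖T x‖ := by
  rw [← sq_eq_sq₀ (norm_nonneg _) (norm_nonneg _),
    ← re_inner_mul_self_apply (CFC.abs_nonneg T).isSelfAdjoint, CFC.abs_mul_abs]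
  exact (ContinuousLinearMap.apply_norm_sq_eq_inner_adjoint_right T x).symm

/-- `⟪x, |T| x⟫ = ‖|T|^{1/2} x‖²`, so the trace of `|T|` is the basis-independent squared
Hilbert–Schmidt norm of `|T|^{1/2}`, while `⟪x, |T| x⟫ ≤ ‖x‖ ‖T x‖`. -/
theorem isTraceClass_of_summable_norm_apply {κ : Type*} (f : HilbertBasis κ ℂ E)
    {T : E →L[ℂ] E} (hT : Summable fun j => ‖T (f j)‖) : IsTraceClass T := by
  intro ι e
  set S := CFC.sqrt (CFC.abs T)
  have hS : IsSelfAdjoint S := (CFC.sqrt_nonneg _).isSelfAdjoint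
  have inner_abs : ∀ x, (⟪x, CFC.abs T x⟫_ℂ).re = ‖S x‖ ^ 2 := fun x => by
    rw [← re_inner_mul_self_apply hS, CFC.sqrt_mul_sqrt_self _ (CFC.abs_nonneg T)]
  have norm_sq_le : ∀ j, ‖S (f j)‖ ^ 2 ≤ ‖T (f j)‖ := fun j => by
    rw [← inner_abs, ← norm_cfcAbs_apply]
    simpa [f.orthonormal.norm_eq_one j] using
      re_inner_le_norm (𝕜 := ℂ) (f j) (CFC.abs T (f j))
  have hsum_f : Summable fun j => ‖S (f j)‖ ^ 2 :=
    hT.of_nonneg_of_le (fun _ => sq_nonneg _) norm_sq_le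
  have hsum_e : ∑' i, ‖S (e i)‖ₑ ^ 2 ≠ ∞ := by
    rw [tsum_enorm_apply_sq_eq_adjoint e f S, hS.adjoint_eq]
    simpa [ENNReal.ofReal_pow] using hsum_f.tsum_ofReal_ne_top
  simpa [inner_abs] using ENNReal.summable_toReal hsum_e

end TraceClass

section SchurTest

variable {n : ℕ}

theorem sq_tsum_mul_le {ι : Type*} (k a : ι → ℝ≥0∞) :
    (∑' j, k j * a j) ^ 2 ≤ (∑' j, k j) * ∑' j, k j * a j ^ 2 := by
  have h : ∑' j, k j * a j ≤ ((∑' j, k j) * ∑' j, k j * a j ^ 2) ^ (2⁻¹ : ℝ) := by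
    refine ENNReal.summable.tsum_le_of_sum_le fun s => ?_
    have holder := ENNReal.inner_le_weight_mul_Lp_of_nonneg s one_le_two k a
    rw [show (1 : ℝ) - 2⁻¹ = 2⁻¹ by norm_num,
      ← ENNReal.mul_rpow_of_nonneg _ _ (by norm_num)] at holder
    simp only [ENNReal.rpow_two] at holder
    refine holder.trans ?_
    gcongr <;> exact ENNReal.sum_le_tsum s
  rwa [← ENNReal.rpow_le_rpow_iff two_pos, ← ENNReal.rpow_mul, inv_mul_cancel₀ two_ne_zero,
    ENNReal.rpow_one, ENNReal.rpow_two] at h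

theorem eval_delta_self (j : ℤ × ℤ) (v : EuclideanSpace ℂ (Fin n)) : eval j (delta j v) = v :=
  lp.single_apply_self (E := fun _ : ℤ × ℤ => EuclideanSpace ℂ (Fin n)) 2 j v

theorem eval_delta_of_ne {i j : ℤ × ℤ} (h : i ≠ j) (v : EuclideanSpace ℂ (Fin n)) :
    eval i (delta j v) = 0 :=
  lp.single_apply_ne (E := fun _ : ℤ × ℤ => EuclideanSpace ℂ (Fin n)) 2 j v h

theorem inner_delta (j : ℤ × ℤ) (v : EuclideanSpace ℂ (Fin n)) (ψ : LatticeSpace n) :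
    ⟪delta j v, ψ⟫_ℂ = ⟪v, eval j ψ⟫_ℂ :=
  lp.inner_single_left (𝕜 := ℂ) (G := fun _ : ℤ × ℤ => EuclideanSpace ℂ (Fin n)) j v ψ

theorem inner_eq_tsum_eval (ψ η : LatticeSpace n) :
    ⟪ψ, η⟫_ℂ = ∑' i, ⟪eval i ψ, eval i η⟫_ℂ :=
  lp.inner_eq_tsum (𝕜 := ℂ) (G := fun _ : ℤ × ℤ => EuclideanSpace ℂ (Fin n)) ψ η

theorem orthonormal_delta_single :
    Orthonormal ℂ fun p : (ℤ × ℤ) × Fin n =>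
      (delta p.1 (EuclideanSpace.single p.2 1) : LatticeSpace n) := by
  rw [orthonormal_iff_ite]
  rintro ⟨i, k⟩ ⟨j, l⟩
  rw [inner_delta]
  obtain rfl | hij := eq_or_ne i j
  · simp [eval_delta_self, EuclideanSpace.inner_single_left]
  · simp [eval_delta_of_ne hij, hij]

/-- The standard orthonormal basis `δ_j ⊗ e_k` of `ℓ²(ℤ²) ⊗ ℂⁿ`. -/
noncomputable def latticeBasis (n : ℕ) : HilbertBasis ((ℤ × ℤ) × Fin n) ℂ (LatticeSpace n) :=
  HilbertBasis.mkOfOrthogonalEqBot orthonormal_delta_single <| by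
    refine (Submodule.eq_bot_iff _).mpr fun ψ hψ => ext_eval fun i => ?_
    ext k
    have hik := hψ _ (Submodule.subset_span ⟨(i, k), rfl⟩)
    rw [inner_delta] at hik
    simpa [EuclideanSpace.inner_single_left] using hik

theorem latticeBasis_apply (p : (ℤ × ℤ) × Fin n) :
    latticeBasis n p = delta p.1 (EuclideanSpace.single p.2 1) := by
  simp [latticeBasis]

theorem tsum_enorm_eval_sq (ψ : LatticeSpace n) : ∑' i, ‖eval i ψ‖ₑ ^ 2 = ‖ψ‖ₑ ^ 2 :=
  tsum_enorm_sq_lp ψ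

theorem hasSum_coeff (A : LatticeSpace n →L[ℂ] LatticeSpace n) (ψ : LatticeSpace n)
    (i : ℤ × ℤ) : HasSum (fun j => coeff A i j (eval j ψ)) (eval i (A ψ)) := by
  have h : HasSum (fun j => delta j (eval j ψ)) ψ :=
    lp.hasSum_single (E := fun _ : ℤ × ℤ => EuclideanSpace ℂ (Fin n)) (p := 2) (by norm_num) ψ
  exact h.mapL (eval i ∘L A)

theorem enorm_eval_apply_le (A : LatticeSpace n →L[ℂ] LatticeSpace n) (ψ : LatticeSpace n)
    (i : ℤ × ℤ) : ‖eval i (A ψ)‖ₑ ≤ ∑' j, ‖coeff A i j‖ₑ * ‖eval j ψ‖ₑ := by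
  rw [← (hasSum_coeff A ψ i).tsum_eq]
  refine enorm_tsum_le_tsum_enorm.trans ?_
  gcongr with j
  exact (coeff A i j).le_opENorm _

theorem enorm_le_of_tsum_enorm_coeff_le {A : LatticeSpace n →L[ℂ] LatticeSpace n} {c : ℝ≥0∞}
    (hrow : ∀ i, ∑' j, ‖coeff A i j‖ₑ ≤ c) (hcol : ∀ j, ∑' i, ‖coeff A i j‖ₑ ≤ c) :
    ‖A‖ₑ ≤ c := by
  refine ContinuousLinearMap.opENorm_le_bound A fun ψ => ?_
  rw [← ENNReal.pow_le_pow_left_iff two_ne_zero]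
  calc ‖A ψ‖ₑ ^ 2 = ∑' i, ‖eval i (A ψ)‖ₑ ^ 2 := (tsum_enorm_eval_sq _).symm
    _ ≤ ∑' i, (∑' j, ‖coeff A i j‖ₑ * ‖eval j ψ‖ₑ) ^ 2 := by
      gcongr with i
      exact enorm_eval_apply_le A ψ i
    _ ≤ ∑' i, c * ∑' j, ‖coeff A i j‖ₑ * ‖eval j ψ‖ₑ ^ 2 := by
      gcongr with i
      exact (sq_tsum_mul_le _ _).trans (mul_le_mul_left (hrow i) _)
    _ = c * ∑' j, (∑' i, ‖coeff A i j‖ₑ) * ‖eval j ψ‖ₑ ^ 2 := by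
      rw [ENNReal.tsum_mul_left, ENNReal.tsum_comm]
      simp_rw [ENNReal.tsum_mul_right]
    _ ≤ c * ∑' j, c * ‖eval j ψ‖ₑ ^ 2 := by
      gcongr with j
      exact hcol j
    _ = (c * ‖ψ‖ₑ) ^ 2 := by
      rw [ENNReal.tsum_mul_left, tsum_enorm_eval_sq]
      ring

end SchurTest

section MultiplicationOperators

variable {n : ℕ}

/-- Multiplication by a bounded real function on the lattice, as a representation of the ring of
such functions (continuity being no restriction on a discrete space). -/
noncomputable def mulOp : (ℤ × ℤ →ᵇ ℝ) →+* (LatticeSpace n →L[ℂ] LatticeSpace n) where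
  toFun f :=
    lp.mapCLM (E := fun _ : ℤ × ℤ => EuclideanSpace ℂ (Fin n)) 2
      (fun i => f i • ContinuousLinearMap.id ℂ (EuclideanSpace ℂ (Fin n))) (norm_nonneg f)
      fun i => by
        rw [norm_smul]
        exact mul_le_of_le_one_right (norm_nonneg _) ContinuousLinearMap.norm_id_le |>.trans
          (f.norm_coe_le_norm i)
  map_one' := ContinuousLinearMap.ext fun ψ => ext_eval fun i => one_smul ℝ (eval i ψ)
  map_mul' f g := ContinuousLinearMap.ext fun ψ => ext_eval fun i =>
    mul_smul (f i) (g i) (eval i ψ)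
  map_zero' := ContinuousLinearMap.ext fun ψ => ext_eval fun i => zero_smul ℝ (eval i ψ)
  map_add' f g := ContinuousLinearMap.ext fun ψ => ext_eval fun i =>
    add_smul (f i) (g i) (eval i ψ)

theorem eval_mulOp (f : ℤ × ℤ →ᵇ ℝ) (ψ : LatticeSpace n) (i : ℤ × ℤ) :
    eval i (mulOp f ψ) = f i • eval i ψ := rfl

theorem mulOp_delta (f : ℤ × ℤ →ᵇ ℝ) (j : ℤ × ℤ) (v : EuclideanSpace ℂ (Fin n)) :
    mulOp f (delta j v) = f j • delta j v := by
  refine ext_eval fun i => ?_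
  rw [eval_mulOp, ContinuousLinearMap.map_smul_of_tower]
  obtain rfl | hij := eq_or_ne i j
  · rfl
  · rw [eval_delta_of_ne hij, smul_zero, smul_zero]

theorem commute_mulOp (f g : ℤ × ℤ →ᵇ ℝ) :
    Commute (mulOp f : LatticeSpace n →L[ℂ] LatticeSpace n) (mulOp g) :=
  (Commute.all f g).map mulOp

theorem isSelfAdjoint_mulOp (f : ℤ × ℤ →ᵇ ℝ) :
    IsSelfAdjoint (mulOp f : LatticeSpace n →L[ℂ] LatticeSpace n) := by
  rw [ContinuousLinearMap.isSelfAdjoint_iff_isSymmetric]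
  intro ψ η
  change ⟪mulOp f ψ, η⟫_ℂ = ⟪ψ, mulOp f η⟫_ℂ
  rw [inner_eq_tsum_eval, inner_eq_tsum_eval]
  simp only [eval_mulOp, inner_smul_left_eq_star_smul, inner_smul_right_eq_smul, conj_trivial]

theorem coeff_sub (A B : LatticeSpace n →L[ℂ] LatticeSpace n) (i j : ℤ × ℤ) :
    coeff (A - B) i j = coeff A i j - coeff B i j := by
  ext1 v
  simp [coeff]

theorem coeff_mulOp_mul (f : ℤ × ℤ →ᵇ ℝ) (A : LatticeSpace n →L[ℂ] LatticeSpace n)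
    (i j : ℤ × ℤ) : coeff (mulOp f * A) i j = f i • coeff A i j := rfl

theorem coeff_mul_mulOp (A : LatticeSpace n →L[ℂ] LatticeSpace n) (f : ℤ × ℤ →ᵇ ℝ)
    (i j : ℤ × ℤ) : coeff (A * mulOp f) i j = f j • coeff A i j := by
  ext1 v
  change eval i (A (mulOp f (delta j v))) = f j • eval i (A (delta j v))
  rw [mulOp_delta, ContinuousLinearMap.map_smul_of_tower, ContinuousLinearMap.map_smul_of_tower]

/-- The indicator function of a set of lattice sites, as a bounded function. -/
noncomputable abbrev indicatorFun (S : Set (ℤ × ℤ)) : ℤ × ℤ →ᵇ ℝ :=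
  BoundedContinuousFunction.indicator S (isClopen_discrete S)

theorem chi_eq_mulOp (S : Set (ℤ × ℤ)) :
    (chi S : LatticeSpace n →L[ℂ] LatticeSpace n) = mulOp (indicatorFun S) := by
  refine ContinuousLinearMap.ext fun ψ => ext_eval fun i => ?_
  change S.indicator (fun i => eval i ψ) i = S.indicator (1 : ℤ × ℤ → ℝ) i • eval i ψ
  by_cases hi : i ∈ S <;> simp [hi]

theorem norm_chi_le (S : Set (ℤ × ℤ)) :
    ‖(chi S : LatticeSpace n →L[ℂ] LatticeSpace n)‖ ≤ 1 :=
  LinearMap.mkContinuous_norm_le _ zero_le_one _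

theorem isIdempotentElem_chi (S : Set (ℤ × ℤ)) :
    IsIdempotentElem (chi S : LatticeSpace n →L[ℂ] LatticeSpace n) := by
  rw [chi_eq_mulOp]
  refine IsIdempotentElem.map ?_ mulOp
  ext i
  by_cases hi : i ∈ S <;> simp [hi]

theorem isSelfAdjoint_contraction (S : Set (ℤ × ℤ)) {H : LatticeSpace n →L[ℂ] LatticeSpace n}
    (hH : IsSelfAdjoint H) : IsSelfAdjoint (contraction S H) := by
  have hχ : IsSelfAdjoint (chi S : LatticeSpace n →L[ℂ] LatticeSpace n) := by
    rw [chi_eq_mulOp]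
    exact isSelfAdjoint_mulOp _
  have h := hH.conjugate (chi S)
  rwa [hχ.star_eq] at h

end MultiplicationOperators

section RapidDecay

theorem latticeDist_nonneg (i j : ℤ × ℤ) : 0 ≤ latticeDist i j := Real.sqrt_nonneg _

theorem abs_fst_sub_le_latticeDist (i j : ℤ × ℤ) : |(i.1 : ℝ) - j.1| ≤ latticeDist i j :=
  Real.abs_le_sqrt (le_add_of_nonneg_right (sq_nonneg _))

theorem abs_snd_sub_le_latticeDist (i j : ℤ × ℤ) : |(i.2 : ℝ) - j.2| ≤ latticeDist i j :=
  Real.abs_le_sqrt (le_add_of_nonneg_left (sq_nonneg _))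

theorem summable_inv_one_add_int_sq : Summable fun x : ℤ => (1 + (x : ℝ) ^ 2)⁻¹ := by
  refine (Real.summable_one_div_int_pow.mpr one_lt_two).of_norm_bounded_eventually ?_
  filter_upwards [Set.finite_singleton (0 : ℤ) |>.compl_mem_cofinite] with x hx
  have hx0 : (x : ℝ) ≠ 0 := by exact_mod_cast hx
  rw [Real.norm_of_nonneg (by positivity), one_div]
  exact inv_anti₀ (by positivity) (le_add_of_nonneg_left zero_le_one)

theorem summable_inv_one_add_sq_mul_one_add_sq :
    Summable fun s : ℤ × ℤ => ((1 + (s.1 : ℝ) ^ 2) * (1 + (s.2 : ℝ) ^ 2))⁻¹ := by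
  simp_rw [mul_inv]
  exact summable_inv_one_add_int_sq.mul_of_nonneg summable_inv_one_add_int_sq
    (fun x => by positivity) (fun x => by positivity)

variable {n : ℕ} {T : LatticeSpace n →L[ℂ] LatticeSpace n}

theorem norm_le_tsum_of_norm_coeff_le {A : LatticeSpace n →L[ℂ] LatticeSpace n}
    {k : ℤ × ℤ → ℝ} (hk : Summable k) (hA : ∀ i j, ‖coeff A i j‖ ≤ k (i - j)) :
    ‖A‖ ≤ ∑' s, k s := by
  have hk0 : ∀ s, 0 ≤ k s := fun s => by simpa using (norm_nonneg _).trans (hA s 0)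
  have hA' : ∀ i j, ‖coeff A i j‖ₑ ≤ ENNReal.ofReal (k (i - j)) := fun i j => by
    rw [← ofReal_norm]
    exact ENNReal.ofReal_le_ofReal (hA i j)
  rw [← ENNReal.ofReal_le_ofReal_iff (tsum_nonneg hk0), ofReal_norm,
    ENNReal.ofReal_tsum_of_nonneg hk0 hk]
  refine enorm_le_of_tsum_enorm_coeff_le (fun i => ?_) fun j => ?_
  · rw [← (Equiv.subLeft i).tsum_eq fun s => ENNReal.ofReal (k s)]
    exact ENNReal.tsum_le_tsum (hA' i)
  · rw [← (Equiv.subRight j).tsum_eq fun s => ENNReal.ofReal (k s)]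
    exact ENNReal.tsum_le_tsum fun i => hA' i j

theorem RapidDecay.exists_pow_mul_norm_coeff_le (hT : RapidDecay T) (p : ℕ) :
    ∃ C, ∀ i j, (1 + latticeDist i j) ^ p * ‖coeff T i j‖ ≤ C := by
  obtain ⟨C₀, h₀⟩ := hT 0 le_rfl
  obtain ⟨C₁, h₁⟩ := hT p (Nat.cast_nonneg p)
  have coeff_le : ∀ i j, ‖coeff T i j‖ ≤ C₀ := fun i j => by
    simpa using h₀ (Set.mem_range_self (i, j))
  have coeff_mul_le : ∀ i j, ‖coeff T i j‖ * latticeDist i j ^ p ≤ C₁ := fun i j => by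
    simpa using h₁ (Set.mem_range_self (i, j))
  refine ⟨2 ^ (p - 1) * (C₀ + C₁), fun i j => ?_⟩
  calc (1 + latticeDist i j) ^ p * ‖coeff T i j‖
      ≤ 2 ^ (p - 1) * (1 ^ p + latticeDist i j ^ p) * ‖coeff T i j‖ := by
        gcongr
        exact add_pow_le zero_le_one (latticeDist_nonneg i j) p
    _ = 2 ^ (p - 1) * (‖coeff T i j‖ + ‖coeff T i j‖ * latticeDist i j ^ p) := by ring
    _ ≤ 2 ^ (p - 1) * (C₀ + C₁) := by
        gcongr
        exacts [coeff_le i j, coeff_mul_le i j]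

theorem one_add_sq_mul_one_add_sq_le (i j : ℤ × ℤ) :
    (1 + (((i - j).1 : ℤ) : ℝ) ^ 2) * (1 + (((i - j).2 : ℤ) : ℝ) ^ 2) ≤
      (1 + latticeDist i j) ^ 4 := by
  have hd := latticeDist_nonneg i j
  have one_add_sq_le : ∀ t : ℝ, |t| ≤ latticeDist i j → 1 + t ^ 2 ≤ (1 + latticeDist i j) ^ 2 :=
    fun t ht => by nlinarith [sq_abs t, abs_nonneg t]
  rw [Prod.fst_sub, Prod.snd_sub, Int.cast_sub, Int.cast_sub,
    show (1 + latticeDist i j) ^ 4 = (1 + latticeDist i j) ^ 2 * (1 + latticeDist i j) ^ 2 by ring]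
  gcongr
  · exact one_add_sq_le _ (abs_fst_sub_le_latticeDist i j)
  · exact one_add_sq_le _ (abs_snd_sub_le_latticeDist i j)

theorem RapidDecay.exists_norm_le (hT : RapidDecay T) (p : ℕ) :
    ∃ S, 0 ≤ S ∧ ∀ (A : LatticeSpace n →L[ℂ] LatticeSpace n) (c : ℝ), 0 ≤ c →
      (∀ i j, ‖coeff A i j‖ ≤ c * (1 + latticeDist i j) ^ p * ‖coeff T i j‖) → ‖A‖ ≤ c * S := by
  obtain ⟨C, hC⟩ := hT.exists_pow_mul_norm_coeff_le (p + 4)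
  have hC0 : 0 ≤ C := by
    refine le_trans ?_ (hC 0 0)
    have hd := latticeDist_nonneg 0 0
    positivity
  refine ⟨∑' s : ℤ × ℤ, C * ((1 + (s.1 : ℝ) ^ 2) * (1 + (s.2 : ℝ) ^ 2))⁻¹,
    tsum_nonneg fun s => by positivity, fun A c hc hA => ?_⟩
  rw [← tsum_mul_left]
  refine norm_le_tsum_of_norm_coeff_le
    ((summable_inv_one_add_sq_mul_one_add_sq.mul_left C).mul_left c) fun i j => ?_
  have hd := latticeDist_nonneg i j
  rw [← div_eq_mul_inv]
  refine (hA i j).trans ?_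
  rw [mul_assoc]
  refine mul_le_mul_of_nonneg_left ((le_div_iff₀ (by positivity)).mpr ?_) hc
  calc (1 + latticeDist i j) ^ p * ‖coeff T i j‖ *
        ((1 + (((i - j).1 : ℤ) : ℝ) ^ 2) * (1 + (((i - j).2 : ℤ) : ℝ) ^ 2))
      ≤ (1 + latticeDist i j) ^ p * ‖coeff T i j‖ * (1 + latticeDist i j) ^ 4 := by
        gcongr
        exact one_add_sq_mul_one_add_sq_le i j
    _ = (1 + latticeDist i j) ^ (p + 4) * ‖coeff T i j‖ := by ring
    _ ≤ C := hC i j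

end RapidDecay

section Weights

/-- A function on the lattice that behaves like the signed distance to the boundary of `S`: it is
`1`-Lipschitz, and points on different sides of the boundary are at least as far from each other
as its values there indicate. -/
structure IsBoundaryFunction (S : Set (ℤ × ℤ)) (f : ℤ × ℤ → ℝ) : Prop where
  abs_sub_le : ∀ i j, |f i - f j| ≤ latticeDist i j
  abs_le : ∀ i j, ¬(i ∈ S ↔ j ∈ S) → |f j| ≤ latticeDist i j

theorem abs_le_abs_sub_of_sign_ne {a b : ℝ} (h : ¬(0 ≤ a ↔ 0 ≤ b)) : |b| ≤ |a - b| := by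
  grind

theorem isBoundaryFunction_halfY : IsBoundaryFunction halfY fun i => i.1 where
  abs_sub_le := abs_fst_sub_le_latticeDist
  abs_le i j h := (abs_le_abs_sub_of_sign_ne (by simpa [halfY] using h)).trans
    (abs_fst_sub_le_latticeDist i j)

theorem isBoundaryFunction_halfW : IsBoundaryFunction halfW fun i => i.2 where
  abs_sub_le := abs_snd_sub_le_latticeDist
  abs_le i j h := (abs_le_abs_sub_of_sign_ne (by simpa [halfW] using h)).trans
    (abs_snd_sub_le_latticeDist i j)

/-- The truncation of `|f|` at height `N`, as a bounded function. -/
noncomputable def truncate (f : ℤ × ℤ → ℝ) (N : ℝ≥0) : ℤ × ℤ →ᵇ ℝ :=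
  BoundedContinuousFunction.ofNormedAddCommGroupDiscrete (fun i => min |f i| N) N fun i => by
    rw [Real.norm_of_nonneg (by positivity)]
    exact min_le_right _ _

theorem truncate_apply (f : ℤ × ℤ → ℝ) (N : ℝ≥0) (i : ℤ × ℤ) : truncate f N i = min |f i| N := rfl

theorem IsBoundaryFunction.truncate {S : Set (ℤ × ℤ)} {f : ℤ × ℤ → ℝ}
    (hf : IsBoundaryFunction S f) (N : ℝ≥0) : IsBoundaryFunction S (truncate f N) where
  abs_sub_le i j := by
    refine (abs_min_sub_min_le_max _ _ _ _).trans ?_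
    rw [sub_self, abs_zero]
    exact max_le ((abs_abs_sub_abs_le _ _).trans (hf.abs_sub_le i j)) (latticeDist_nonneg i j)
  abs_le i j h := by
    rw [truncate_apply, abs_of_nonneg (by positivity)]
    exact (min_le_left _ _).trans (hf.abs_le i j h)

/-- The weight `1 + (κ f)²`, as a unit of the ring of bounded functions. -/
noncomputable def weight (κ : ℝ) (f : ℤ × ℤ →ᵇ ℝ) : (ℤ × ℤ →ᵇ ℝ)ˣ where
  val := 1 + (κ • f) ^ 2
  inv := BoundedContinuousFunction.ofNormedAddCommGroupDiscrete (fun i => (1 + (κ * f i) ^ 2)⁻¹) 1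
    fun i => by
      rw [Real.norm_of_nonneg (by positivity)]
      exact inv_le_one_of_one_le₀ (le_add_of_nonneg_right (sq_nonneg _))
  val_inv := by
    ext i
    exact mul_inv_cancel₀ (by positivity : 1 + (κ * f i) ^ 2 ≠ 0)
  inv_val := by
    ext i
    exact inv_mul_cancel₀ (by positivity : 1 + (κ * f i) ^ 2 ≠ 0)

variable {κ : ℝ} {f : ℤ × ℤ →ᵇ ℝ}

theorem weight_apply (κ : ℝ) (f : ℤ × ℤ →ᵇ ℝ) (i : ℤ × ℤ) :
    (weight κ f : ℤ × ℤ →ᵇ ℝ) i = 1 + (κ * f i) ^ 2 := rfl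

theorem inv_weight_apply (κ : ℝ) (f : ℤ × ℤ →ᵇ ℝ) (i : ℤ × ℤ) :
    (↑(weight κ f)⁻¹ : ℤ × ℤ →ᵇ ℝ) i = (1 + (κ * f i) ^ 2)⁻¹ := rfl

theorem abs_one_add_mul_sq_sub_le {κ s t d : ℝ} (hκ0 : 0 ≤ κ) (hκ1 : κ ≤ 1) (h : |s - t| ≤ d) :
    |(1 + (κ * t) ^ 2) - (1 + (κ * s) ^ 2)| ≤ κ * (d + d ^ 2) * (1 + (κ * s) ^ 2) := by
  have hd : 0 ≤ d := (abs_nonneg _).trans h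
  have abs_add_le : |t + s| ≤ d + 2 * |s| := by
    calc |t + s| = |(t - s) + 2 * s| := by ring_nf
      _ ≤ |t - s| + |2 * s| := abs_add_le _ _
      _ ≤ d + 2 * |s| := by rw [abs_sub_comm, abs_mul, abs_two]; gcongr
  have two_mul_le : κ * (2 * |s|) ≤ 1 + (κ * s) ^ 2 := by
    rw [mul_pow, ← sq_abs s]
    linarith [sq_nonneg (κ * |s| - 1)]
  calc |(1 + (κ * t) ^ 2) - (1 + (κ * s) ^ 2)| = |κ ^ 2 * ((s - t) * (t + s))| := by
        rw [← abs_neg]; ring_nf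
    _ = κ ^ 2 * (|s - t| * |t + s|) := by
        rw [abs_mul, abs_mul, abs_of_nonneg (sq_nonneg κ)]
    _ ≤ κ ^ 2 * (d * (d + 2 * |s|)) := by gcongr
    _ = κ * (d * (κ * (2 * |s|)) + κ * d ^ 2 * 1) := by ring
    _ ≤ κ * (d * (1 + (κ * s) ^ 2) + 1 * d ^ 2 * (1 + (κ * s) ^ 2)) := by
        gcongr
        exact le_add_of_nonneg_right (sq_nonneg _)
    _ = κ * (d + d ^ 2) * (1 + (κ * s) ^ 2) := by ring

theorem abs_inv_weight_mul_weight_sub_one_le {S : Set (ℤ × ℤ)} (hκ0 : 0 ≤ κ) (hκ1 : κ ≤ 1)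
    (hf : IsBoundaryFunction S f) (i j : ℤ × ℤ) :
    |(↑(weight κ f)⁻¹ : ℤ × ℤ →ᵇ ℝ) i * (weight κ f : ℤ × ℤ →ᵇ ℝ) j - 1| ≤
      κ * (latticeDist i j + latticeDist i j ^ 2) := by
  have hw : 0 < 1 + (κ * f i) ^ 2 := by positivity
  rw [weight_apply, inv_weight_apply, ← div_eq_inv_mul, div_sub_one hw.ne', abs_div,
    abs_of_pos hw, div_le_iff₀ hw]
  exact abs_one_add_mul_sq_sub_le hκ0 hκ1 (hf.abs_sub_le i j)

theorem abs_inv_weight_mul_weight_le {S : Set (ℤ × ℤ)} (hκ0 : 0 ≤ κ) (hκ1 : κ ≤ 1)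
    (hf : IsBoundaryFunction S f) (i j : ℤ × ℤ) :
    |(↑(weight κ f)⁻¹ : ℤ × ℤ →ᵇ ℝ) i * (weight κ f : ℤ × ℤ →ᵇ ℝ) j| ≤
      (1 + latticeDist i j) ^ 2 := by
  have hd := latticeDist_nonneg i j
  have h := abs_inv_weight_mul_weight_sub_one_le hκ0 hκ1 hf i j
  have hκ := mul_le_of_le_one_left (by positivity : 0 ≤ latticeDist i j + latticeDist i j ^ 2) hκ1
  have htri := abs_sub_abs_le_abs_sub
    ((↑(weight κ f)⁻¹ : ℤ × ℤ →ᵇ ℝ) i * (weight κ f : ℤ × ℤ →ᵇ ℝ) j) 1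
  rw [abs_one] at htri
  nlinarith

theorem abs_weight_le {S : Set (ℤ × ℤ)} (hκ0 : 0 ≤ κ) (hκ1 : κ ≤ 1)
    (hf : IsBoundaryFunction S f) {i j : ℤ × ℤ} (hij : ¬(i ∈ S ↔ j ∈ S)) :
    |(weight κ f : ℤ × ℤ →ᵇ ℝ) j| ≤ (1 + latticeDist i j) ^ 2 := by
  have hd := latticeDist_nonneg i j
  have h : |κ * f j| ≤ latticeDist i j := by
    rw [abs_mul, abs_of_nonneg hκ0]
    exact (mul_le_of_le_one_left (abs_nonneg _) hκ1).trans (hf.abs_le i j hij)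
  rw [weight_apply, abs_of_pos (by positivity)]
  nlinarith [sq_le_sq' (neg_le_of_abs_le h) (le_of_abs_le h)]

theorem abs_indicatorFun_le_one (S : Set (ℤ × ℤ)) (i : ℤ × ℤ) : |indicatorFun S i| ≤ 1 := by
  by_cases hi : i ∈ S <;> simp [hi]

theorem abs_indicatorFun_mul_one_sub_mul_weight_le {S : Set (ℤ × ℤ)}
    (hκ0 : 0 ≤ κ) (hκ1 : κ ≤ 1) (hf : IsBoundaryFunction S f) (i j : ℤ × ℤ) :
    |indicatorFun S i * (1 - indicatorFun S j) * (weight κ f : ℤ × ℤ →ᵇ ℝ) j| ≤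
      (1 + latticeDist i j) ^ 2 := by
  by_cases hij : i ∈ S ↔ j ∈ S
  · have h : indicatorFun S i * (1 - indicatorFun S j) = 0 := by
      by_cases hi : i ∈ S
      · simp [hij.mp hi]
      · simp [hi]
    rw [h, zero_mul, abs_zero]
    exact sq_nonneg _
  · refine le_trans ?_ (abs_weight_le hκ0 hκ1 hf hij)
    rw [abs_mul]
    refine mul_le_of_le_one_left (abs_nonneg _) ?_
    by_cases hi : i ∈ S <;> by_cases hj : j ∈ S <;> simp [hi, hj]

theorem abs_indicatorFun_sub_mul_weight_le {S : Set (ℤ × ℤ)} (hκ0 : 0 ≤ κ)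
    (hκ1 : κ ≤ 1) (hf : IsBoundaryFunction S f) (i j : ℤ × ℤ) :
    |(indicatorFun S j - indicatorFun S i) * (weight κ f : ℤ × ℤ →ᵇ ℝ) j| ≤
      (1 + latticeDist i j) ^ 2 := by
  by_cases hij : i ∈ S ↔ j ∈ S
  · have h : indicatorFun S j - indicatorFun S i = 0 := by
      by_cases hi : i ∈ S
      · simp [hi, hij.mp hi]
      · simp [hi, mt hij.mpr hi]
    rw [h, zero_mul, abs_zero]
    exact sq_nonneg _
  · refine le_trans ?_ (abs_weight_le hκ0 hκ1 hf hij)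
    rw [abs_mul]
    refine mul_le_of_le_one_left (abs_nonneg _) ?_
    by_cases hi : i ∈ S <;> by_cases hj : j ∈ S <;> simp [hi, hj]

end Weights

section Conjugation

variable {n : ℕ} {H : LatticeSpace n →L[ℂ] LatticeSpace n}

theorem RapidDecay.exists_norm_weight_conj_sub_le (hH : RapidDecay H) :
    ∃ C, 0 ≤ C ∧ ∀ (S : Set (ℤ × ℤ)) (κ : ℝ) (f : ℤ × ℤ →ᵇ ℝ), 0 ≤ κ → κ ≤ 1 →
      IsBoundaryFunction S f → ‖mulOp ↑(weight κ f)⁻¹ * H * mulOp (weight κ f) - H‖ ≤ κ * C := by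
  obtain ⟨C, hC0, hC⟩ := hH.exists_norm_le 2
  refine ⟨C, hC0, fun S κ f hκ0 hκ1 hf => hC _ κ hκ0 fun i j => ?_⟩
  have hd := latticeDist_nonneg i j
  have coeff_eq : coeff (mulOp ↑(weight κ f)⁻¹ * H * mulOp (weight κ f) - H) i j =
      ((↑(weight κ f)⁻¹ : ℤ × ℤ →ᵇ ℝ) i * (weight κ f : ℤ × ℤ →ᵇ ℝ) j - 1) • coeff H i j := by
    rw [coeff_sub, coeff_mul_mulOp, coeff_mulOp_mul, smul_smul, mul_comm]
    module
  rw [coeff_eq, norm_smul]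
  gcongr
  exact (abs_inv_weight_mul_weight_sub_one_le hκ0 hκ1 hf i j).trans (by gcongr; nlinarith)

theorem RapidDecay.exists_norm_boundary_mul_weight_le (hH : RapidDecay H) :
    ∃ C, ∀ (S : Set (ℤ × ℤ)) (κ : ℝ) (f : ℤ × ℤ →ᵇ ℝ), 0 ≤ κ → κ ≤ 1 →
      IsBoundaryFunction S f →
        ‖(chi S * H * (1 - chi S) * mulOp (weight κ f) :
          LatticeSpace n →L[ℂ] LatticeSpace n)‖ ≤ C := by
  obtain ⟨C, -, hC⟩ := hH.exists_norm_le 2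
  refine ⟨1 * C, fun S κ f hκ0 hκ1 hf => hC _ 1 zero_le_one fun i j => ?_⟩
  have coeff_eq : coeff (chi S * H * (1 - chi S) * mulOp (weight κ f)) i j =
      (indicatorFun S i * (1 - indicatorFun S j) * (weight κ f : ℤ × ℤ →ᵇ ℝ) j) •
        coeff H i j := by
    rw [chi_eq_mulOp, ← map_one mulOp, ← map_sub, coeff_mul_mulOp, coeff_mul_mulOp,
      coeff_mulOp_mul, smul_smul, smul_smul, BoundedContinuousFunction.sub_apply,
      BoundedContinuousFunction.coe_one, Pi.one_apply]
    congr 1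
    ring
  rw [coeff_eq, norm_smul, one_mul]
  gcongr
  exact abs_indicatorFun_mul_one_sub_mul_weight_le hκ0 hκ1 hf i j

theorem RapidDecay.exists_norm_weight_conj_commutator_le (hH : RapidDecay H) :
    ∃ C, ∀ (Y W : Set (ℤ × ℤ)) (κ : ℝ) (f g : ℤ × ℤ →ᵇ ℝ), 0 ≤ κ → κ ≤ 1 →
      IsBoundaryFunction Y f → IsBoundaryFunction W g →
        ‖(mulOp ↑(weight κ f)⁻¹ * ⁅contraction Y H, chi W⁆ * (mulOp (weight κ f) *
          mulOp (weight 1 g)) : LatticeSpace n →L[ℂ] LatticeSpace n)‖ ≤ C := by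
  obtain ⟨C, -, hC⟩ := hH.exists_norm_le 4
  refine ⟨1 * C, fun Y W κ f g hκ0 hκ1 hf hg => hC _ 1 zero_le_one fun i j => ?_⟩
  have hd := latticeDist_nonneg i j
  have coeff_eq : coeff (mulOp ↑(weight κ f)⁻¹ * ⁅contraction Y H, chi W⁆ *
      (mulOp (weight κ f) * mulOp (weight 1 g))) i j =
      (indicatorFun Y i * indicatorFun Y j *
        ((↑(weight κ f)⁻¹ : ℤ × ℤ →ᵇ ℝ) i * (weight κ f : ℤ × ℤ →ᵇ ℝ) j) *
        ((indicatorFun W j - indicatorFun W i) * (weight 1 g : ℤ × ℤ →ᵇ ℝ) j)) • coeff H i j := by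
    rw [← map_mul, coeff_mul_mulOp, coeff_mulOp_mul, Ring.lie_def, contraction, coeff_sub,
      chi_eq_mulOp, chi_eq_mulOp, coeff_mul_mulOp, coeff_mulOp_mul, coeff_mul_mulOp,
      coeff_mulOp_mul, BoundedContinuousFunction.mul_apply]
    module
  rw [coeff_eq, norm_smul, one_mul]
  gcongr
  rw [Real.norm_eq_abs, abs_mul, abs_mul]
  calc |indicatorFun Y i * indicatorFun Y j| *
        |(↑(weight κ f)⁻¹ : ℤ × ℤ →ᵇ ℝ) i * (weight κ f : ℤ × ℤ →ᵇ ℝ) j| *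
        |(indicatorFun W j - indicatorFun W i) * (weight 1 g : ℤ × ℤ →ᵇ ℝ) j|
      ≤ 1 * (1 + latticeDist i j) ^ 2 * (1 + latticeDist i j) ^ 2 := by
        gcongr
        · rw [abs_mul]
          exact mul_le_one₀ (abs_indicatorFun_le_one Y i) (abs_nonneg _)
            (abs_indicatorFun_le_one Y j)
        · exact abs_inv_weight_mul_weight_le hκ0 hκ1 hf i j
        · exact abs_indicatorFun_sub_mul_weight_le zero_le_one le_rfl hg i j
    _ = (1 + latticeDist i j) ^ 4 := by ring

end Conjugation

section SpectralGap

variable {A : Type*} [CStarAlgebra A]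

theorem exists_unit_eq_sub_of_gap {a : A} (ha : IsSelfAdjoint a) {z r : ℝ} (hr : 0 < r)
    (hgap : ∀ t ∈ spectrum ℝ a, r ≤ |t - z|) :
    ∃ u : Aˣ, (u : A) = a - algebraMap ℝ A z ∧ ‖(↑u⁻¹ : A)‖ ≤ r⁻¹ := by
  have hne : ∀ t ∈ spectrum ℝ a, t - z ≠ 0 := fun t ht => abs_pos.mp (hr.trans_le (hgap t ht))
  refine ⟨cfcUnits (fun t => t - z) a hne, ?_, norm_cfc_le (inv_nonneg.mpr hr.le) fun t ht => ?_⟩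
  · change cfc (fun t => t - z) a = _
    rw [cfc_sub (fun t => t) (fun _ => z) a, cfc_id' ℝ a, cfc_const z a]
  · rw [norm_inv, Real.norm_eq_abs]
    exact inv_anti₀ hr (hgap t ht)

theorem exists_cfc_mul_sub_eq_mul_cfc {a : A} (ha : IsSelfAdjoint a) {φ : ℝ → ℝ}
    (hφ : Continuous φ) {z r : ℝ} (hr : 0 ≤ r) (hφ_supp : ∀ t, φ t ≠ 0 → |t - z| ≤ r) :
    ∃ l : A, ‖l‖ ≤ r ∧ cfc φ a * (a - algebraMap ℝ A z) = l * cfc φ a := by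
  refine ⟨cfc (fun t => max (-r) (min r (t - z))) a, norm_cfc_le hr fun t _ => ?_, ?_⟩
  · exact abs_le.mpr ⟨le_max_left _ _, max_le (by linarith) (min_le_left _ _)⟩
  · have h : a - algebraMap ℝ A z = cfc (fun t : ℝ => t - z) a := by
      rw [cfc_sub (fun t => t) (fun _ => z) a, cfc_id' ℝ a, cfc_const z a]
    rw [h, ← cfc_mul _ _ a, ← cfc_mul _ _ a]
    refine cfc_congr fun t _ => ?_
    by_cases ht : φ t = 0
    · simp [ht]
    · obtain ⟨h₁, h₂⟩ := abs_le.mp (hφ_supp t ht)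
      simp only [min_eq_right h₂, max_eq_right h₁, mul_comm]

end SpectralGap

section Parametrix

variable {A : Type*} [NormedRing A]

theorem norm_inv_le_of_norm_sub_le {u v : Aˣ} {r ε : ℝ} (hr : 0 < r) (hε : ε < r)
    (hu : ‖(↑u⁻¹ : A)‖ ≤ r⁻¹) (huv : ‖(v - u : A)‖ ≤ ε) : ‖(↑v⁻¹ : A)‖ ≤ (r - ε)⁻¹ := by
  have h : ‖(↑v⁻¹ : A)‖ ≤ r⁻¹ + r⁻¹ * ε * ‖(↑v⁻¹ : A)‖ := by
    calc ‖(↑v⁻¹ : A)‖ = ‖(↑u⁻¹ - ↑u⁻¹ * (v - u) * ↑v⁻¹ : A)‖ := by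
          congr 1
          simp [mul_sub, sub_mul, mul_assoc]
      _ ≤ ‖(↑u⁻¹ : A)‖ + ‖(↑u⁻¹ : A)‖ * ‖(v - u : A)‖ * ‖(↑v⁻¹ : A)‖ :=
        (norm_sub_le _ _).trans (by gcongr; exact norm_mul₃_le)
      _ ≤ r⁻¹ + r⁻¹ * ε * ‖(↑v⁻¹ : A)‖ := by gcongr
  rw [← one_div (r - ε), le_div_iff₀ (sub_pos.mpr hε)]
  have h' := mul_le_mul_of_nonneg_left h hr.le
  rw [mul_add, mul_assoc, mul_inv_cancel_left₀ hr.ne', mul_inv_cancel₀ hr.ne'] at h'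
  linarith

theorem norm_mul_le_of_eq_add {t l m x k b : A} {r ρ : ℝ} (htl : t * l = m * t)
    (hx : x = k + l * x * b) (hm : ‖m‖ ≤ r) (hb : ‖b‖ ≤ ρ) (hrρ : r * ρ < 1) :
    ‖t * x‖ ≤ ‖t‖ * ‖k‖ / (1 - r * ρ) := by
  have htx : t * x = t * k + m * (t * x) * b := by
    nth_rw 1 [hx]
    rw [mul_add, ← mul_assoc, ← mul_assoc, htl, mul_assoc m]
  have h : ‖t * x‖ ≤ ‖t‖ * ‖k‖ + r * ‖t * x‖ * ρ := by
    have hr := (norm_nonneg m).trans hm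
    calc ‖t * x‖ = ‖t * k + m * (t * x) * b‖ := congrArg _ htx
      _ ≤ ‖t‖ * ‖k‖ + ‖m‖ * ‖t * x‖ * ‖b‖ :=
        (norm_add_le _ _).trans (add_le_add (norm_mul_le _ _) norm_mul₃_le)
      _ ≤ ‖t‖ * ‖k‖ + r * ‖t * x‖ * ρ := by gcongr
  rw [le_div_iff₀ (sub_pos.mpr hrρ)]
  linarith

theorem mul_eq_boundary_add_sub_mul {R : Type*} [Ring R] {p h s : R} {u w : Rˣ}
    (hp : IsIdempotentElem p) (hps : Commute p s) (hpw : Commute p w) (hu : (u : R) = h - s) :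
    p * w = p * h * (1 - p) * w * (↑w⁻¹ * ↑u⁻¹ * w * p) +
      (p * h * p - s) * (p * w) * (↑w⁻¹ * ↑u⁻¹ * w * p) := by
  have split : p * h * (1 - p) + (p * h * p - s) * p = p * u := by
    rw [hu, mul_sub, mul_sub, hps.eq, sub_mul, mul_assoc (p * h) p p, hp.eq]
    noncomm_ring
  calc p * w = p * w * p := by rw [mul_assoc, ← hpw.eq, ← mul_assoc, hp.eq]
    _ = p * u * (↑u⁻¹ * w * p) := by simp only [mul_assoc, Units.mul_inv_cancel_left]
    _ = (p * h * (1 - p) + (p * h * p - s) * p) * w * (↑w⁻¹ * ↑u⁻¹ * w * p) := by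
      rw [split]
      simp only [mul_assoc, Units.mul_inv_cancel_left]
    _ = _ := by noncomm_ring

theorem norm_mul_le_of_norm_conj_sub_le {t m p h s : A} {u w : Aˣ} {r r' ε : ℝ}
    (hp : IsIdempotentElem p) (hp_norm : ‖p‖ ≤ 1) (hps : Commute p s) (hws : Commute ↑w s)
    (hpw : Commute p w) (hu : (u : A) = h - s) (hu_inv : ‖(↑u⁻¹ : A)‖ ≤ r⁻¹)
    (ht : t * (p * h * p - s) = m * t) (hm : ‖m‖ ≤ r') (hε : ‖↑w⁻¹ * h * w - h‖ ≤ ε)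
    (hr : r' + ε < r) :
    ‖t * (p * w)‖ ≤ ‖t‖ * (‖p * h * (1 - p) * w‖ * (r - ε)⁻¹) / (1 - r' * (r - ε)⁻¹) := by
  have hε0 := (norm_nonneg _).trans hε
  have hr'0 := (norm_nonneg _).trans hm
  have conj_sub : ((w⁻¹ * u * w : Aˣ) - u : A) = ↑w⁻¹ * h * w - h := by
    have hconj : ↑w⁻¹ * s * w = s := by rw [mul_assoc, ← hws.eq, Units.inv_mul_cancel_left]
    rw [Units.val_mul, Units.val_mul, hu, mul_sub, sub_mul, hconj, sub_sub_sub_cancel_right]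
  have norm_conj_inv : ‖(↑w⁻¹ * ↑u⁻¹ * w : A)‖ ≤ (r - ε)⁻¹ := by
    have h := norm_inv_le_of_norm_sub_le (v := w⁻¹ * u * w) (by linarith) (by linarith) hu_inv
      (conj_sub ▸ hε)
    simpa [mul_assoc] using h
  have norm_parametrix : ‖(↑w⁻¹ * ↑u⁻¹ * w * p : A)‖ ≤ (r - ε)⁻¹ :=
    (norm_mul_le _ _).trans (mul_le_of_le_one_right (norm_nonneg _) hp_norm |>.trans norm_conj_inv)
  have hρ : r' * (r - ε)⁻¹ < 1 := by
    rw [← div_eq_mul_inv, div_lt_one (by linarith)]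
    linarith
  refine (norm_mul_le_of_eq_add ht (mul_eq_boundary_add_sub_mul hp hps hpw hu) hm
    norm_parametrix hρ).trans ?_
  have := sub_pos.mpr hρ
  gcongr
  exact (norm_mul_le _ _).trans (by gcongr)

end Parametrix

section EdgeOperator

variable {n : ℕ} {H : LatticeSpace n →L[ℂ] LatticeSpace n} {φ : ℝ → ℝ}

theorem exists_norm_cfc_contraction_mul_weight_le (hH : IsSelfAdjoint H) (hdecay : RapidDecay H)
    (hφ : Continuous φ) {z r : ℝ} (hr : 0 < r) (hgap : ∀ t ∈ spectrum ℝ H, r ≤ |t - z|)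
    (hφ_supp : tsupport φ ⊆ Metric.ball z r) (Y : Set (ℤ × ℤ)) :
    ∃ κ, 0 < κ ∧ κ ≤ 1 ∧ ∃ C, ∀ f : ℤ × ℤ →ᵇ ℝ, IsBoundaryFunction Y f →
      ‖cfc φ (contraction Y H) * (chi Y * mulOp (weight κ f))‖ ≤ C := by
  obtain ⟨r', ⟨hr'0, hr'⟩, hr'_supp⟩ :=
    exists_pos_lt_subset_ball hr (isClosed_tsupport φ) hφ_supp
  obtain ⟨u, hu, hu_inv⟩ := exists_unit_eq_sub_of_gap hH hr hgap
  obtain ⟨m, hm, hφm⟩ := exists_cfc_mul_sub_eq_mul_cfc (isSelfAdjoint_contraction Y hH) hφ hr'0.le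
    fun t ht => (Metric.mem_ball.mp (hr'_supp (subset_tsupport φ ht))).le
  obtain ⟨S, hS0, hS⟩ := hdecay.exists_norm_weight_conj_sub_le
  obtain ⟨B, hB⟩ := hdecay.exists_norm_boundary_mul_weight_le
  obtain ⟨κ, hκ0, hκ1, hκ⟩ : ∃ κ, 0 < κ ∧ κ ≤ 1 ∧ r' + κ * S < r := by
    obtain ⟨c, hc0, hc⟩ := exists_pos_mul_lt (sub_pos.mpr hr') S
    have hmin : min 1 c * S ≤ c * S := by gcongr; exact min_le_right _ _
    exact ⟨min 1 c, lt_min one_pos hc0, min_le_left _ _, by linarith⟩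
  have hinv : 0 < (r - κ * S)⁻¹ := inv_pos.mpr (by linarith)
  have hden : 0 < 1 - r' * (r - κ * S)⁻¹ := by
    rw [sub_pos, ← div_eq_mul_inv, div_lt_one (by linarith)]
    linarith
  refine ⟨κ, hκ0, hκ1, ‖cfc φ (contraction Y H)‖ * (B * (r - κ * S)⁻¹) /
    (1 - r' * (r - κ * S)⁻¹), fun f hf => ?_⟩
  refine (norm_mul_le_of_norm_conj_sub_le
    (w := Units.map (mulOp (n := n)).toMonoidHom (weight κ f)) (isIdempotentElem_chi Y)
    (norm_chi_le Y) (Algebra.commute_algebraMap_right z _) (Algebra.commute_algebraMap_right z _)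
    ?_ hu hu_inv hφm hm (hS Y κ f hκ0.le hκ1 hf) hκ).trans ?_
  · rw [chi_eq_mulOp]
    exact commute_mulOp _ _
  · gcongr
    exact hB Y κ f hκ0.le hκ1 hf

theorem chi_mul_commutator (Y W : Set (ℤ × ℤ)) (H : LatticeSpace n →L[ℂ] LatticeSpace n) :
    chi Y * ⁅contraction Y H, chi (n := n) W⁆ = ⁅contraction Y H, chi (n := n) W⁆ := by
  have hχ := (isIdempotentElem_chi (n := n) Y).eq
  have hYW : (chi Y * chi W : LatticeSpace n →L[ℂ] LatticeSpace n) = chi W * chi Y := by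
    rw [chi_eq_mulOp, chi_eq_mulOp]
    exact commute_mulOp _ _
  have hcontr : chi Y * contraction Y H = contraction Y H := by
    rw [contraction, ← mul_assoc, ← mul_assoc, hχ]
  rw [Ring.lie_def, mul_sub, ← mul_assoc, ← mul_assoc, hcontr, hYW, mul_assoc, hcontr]

theorem exists_norm_cfc_mul_commutator_mul_weight_le (hH : IsSelfAdjoint H)
    (hdecay : RapidDecay H) (hφ : Continuous φ) {z r : ℝ} (hr : 0 < r)
    (hgap : ∀ t ∈ spectrum ℝ H, r ≤ |t - z|) (hφ_supp : tsupport φ ⊆ Metric.ball z r)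
    (Y W : Set (ℤ × ℤ)) :
    ∃ κ, 0 < κ ∧ κ ≤ 1 ∧ ∃ C, ∀ f g : ℤ × ℤ →ᵇ ℝ, IsBoundaryFunction Y f →
      IsBoundaryFunction W g → ‖cfc φ (contraction Y H) * ⁅contraction Y H, chi (n := n) W⁆ *
        (mulOp (weight κ f) * mulOp (weight 1 g))‖ ≤ C := by
  obtain ⟨κ, hκ0, hκ1, C₁, hC₁⟩ :=
    exists_norm_cfc_contraction_mul_weight_le hH hdecay hφ hr hgap hφ_supp Y
  obtain ⟨C₂, hC₂⟩ := hdecay.exists_norm_weight_conj_commutator_le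
  refine ⟨κ, hκ0, hκ1, C₁ * C₂, fun f g hf hg => ?_⟩
  set D := ⁅contraction Y H, chi (n := n) W⁆
  set w : LatticeSpace n →L[ℂ] LatticeSpace n := mulOp (weight κ f)
  set w' : LatticeSpace n →L[ℂ] LatticeSpace n := mulOp ↑(weight κ f)⁻¹
  have hw : w * w' = 1 := by rw [← map_mul, Units.mul_inv, map_one]
  calc ‖cfc φ (contraction Y H) * D * (w * mulOp (weight 1 g))‖
      = ‖cfc φ (contraction Y H) * (chi Y * w) * (w' * D * (w * mulOp (weight 1 g)))‖ := by
        simp only [mul_assoc]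
        rw [← mul_assoc w w', hw, one_mul, ← mul_assoc (chi Y) D, chi_mul_commutator]
    _ ≤ C₁ * C₂ := norm_mul_le_of_le (hC₁ f hf) (hC₂ Y W κ f g hκ0.le hκ1 hf hg)

theorem norm_apply_latticeBasis_le {A : LatticeSpace n →L[ℂ] LatticeSpace n} {κ C : ℝ}
    {Y W : Set (ℤ × ℤ)} {f g : ℤ × ℤ → ℝ} (hκ0 : 0 < κ) (hκ1 : κ ≤ 1)
    (hA : ∀ f g : ℤ × ℤ →ᵇ ℝ, IsBoundaryFunction Y f → IsBoundaryFunction W g →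
      ‖A * (mulOp (weight κ f) * mulOp (weight 1 g))‖ ≤ C)
    (hf : IsBoundaryFunction Y f) (hg : IsBoundaryFunction W g) (p : (ℤ × ℤ) × Fin n) :
    ‖A (latticeBasis n p)‖ ≤ C * (κ ^ 2)⁻¹ * ((1 + f p.1 ^ 2) * (1 + g p.1 ^ 2))⁻¹ := by
  obtain ⟨j, e⟩ := p
  let N : ℝ≥0 := max ‖f j‖₊ ‖g j‖₊
  have truncate_f : truncate f N j = |f j| := min_eq_left (le_max_left _ _)
  have truncate_g : truncate g N j = |g j| := min_eq_left (le_max_right _ _)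
  let w : LatticeSpace n →L[ℂ] LatticeSpace n :=
    mulOp (weight κ (truncate f N)) * mulOp (weight 1 (truncate g N))
  have apply_eq : (A * w) (latticeBasis n (j, e)) =
      ((1 + κ ^ 2 * f j ^ 2) * (1 + g j ^ 2)) • A (latticeBasis n (j, e)) := by
    rw [show w = mulOp _ from (map_mul mulOp _ _).symm, mul_apply_eq_comp, latticeBasis_apply,
      mulOp_delta, ContinuousLinearMap.map_smul_of_tower, BoundedContinuousFunction.mul_apply,
      weight_apply, weight_apply, truncate_f, truncate_g, one_mul, mul_pow, sq_abs, sq_abs]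
  have norm_le : (1 + κ ^ 2 * f j ^ 2) * (1 + g j ^ 2) * ‖A (latticeBasis n (j, e))‖ ≤ C := by
    have h := ContinuousLinearMap.le_of_opNorm_le _
      (hA _ _ (hf.truncate N) (hg.truncate N)) (latticeBasis n (j, e))
    rwa [apply_eq, norm_smul, Real.norm_of_nonneg (by positivity), (latticeBasis n).orthonormal.1,
      mul_one] at h
  have weight_le : κ ^ 2 * (1 + f j ^ 2) ≤ 1 + κ ^ 2 * f j ^ 2 := by
    linarith [pow_le_one₀ hκ0.le hκ1 (n := 2)]
  rw [mul_assoc, ← mul_inv, ← div_eq_mul_inv, le_div_iff₀ (by positivity), mul_comm, ← mul_assoc]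
  exact le_trans (by gcongr) norm_le

end EdgeOperator

end EdgeTrace

open EdgeTrace in
theorem mainTheorem4_general {n : ℕ} {H : LatticeSpace n →L[ℂ] LatticeSpace n}
    (hH : IsSelfAdjoint H) (hdecay : RapidDecay H) {Y W : Set (ℤ × ℤ)} {f g : ℤ × ℤ → ℝ}
    (hf : IsBoundaryFunction Y f) (hg : IsBoundaryFunction W g)
    (hfg : Summable fun j => ((1 + f j ^ 2) * (1 + g j ^ 2))⁻¹)
    {a b : ℝ} (hab : a < b) (hgap : Disjoint (Set.Ioo a b) (spectrum ℝ H))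
    {φ : ℝ → ℝ} (hφ : Continuous φ) (hφ_supp : tsupport φ ⊆ Set.Ioo a b) :
    IsTraceClass
      (cfc φ (contraction Y H) * (Complex.I • ⁅contraction Y H, chi (n := n) W⁆)) := by
  rw [Real.Ioo_eq_ball] at hgap hφ_supp
  have dist_le : ∀ t ∈ spectrum ℝ H, (b - a) / 2 ≤ |t - (a + b) / 2| := fun t ht =>
    not_lt.mp fun h => hgap.notMem_of_mem_right ht (Metric.mem_ball.mpr h)
  obtain ⟨κ, hκ0, hκ1, C, hC⟩ := exists_norm_cfc_mul_commutator_mul_weight_le hH hdecay hφ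
    (half_pos (sub_pos.mpr hab)) dist_le hφ_supp Y W
  have hsum : Summable fun p : (ℤ × ℤ) × Fin n =>
      C * (κ ^ 2)⁻¹ * ((1 + f p.1 ^ 2) * (1 + g p.1 ^ 2))⁻¹ := by
    simpa using (hfg.mul_of_nonneg (Summable.of_finite (f := fun _ : Fin n => (1 : ℝ)))
      (fun j => by positivity) fun _ => zero_le_one).mul_left (C * (κ ^ 2)⁻¹)
  refine isTraceClass_of_summable_norm_apply (latticeBasis n)
    (hsum.of_nonneg_of_le (fun p => norm_nonneg _) fun p => ?_)
  rw [mul_smul_comm, smul_apply, norm_smul, Complex.norm_I, one_mul]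
  exact norm_apply_latticeBasis_le hκ0 hκ1 hC hf hg p

theorem mainTheorem4 (n : ℕ)
    (H : EdgeTrace.LatticeSpace n →L[ℂ] EdgeTrace.LatticeSpace n)
    (hH : IsSelfAdjoint H) (hdecay : EdgeTrace.RapidDecay H)
    (a b E : ℝ) (hE : E ∈ Set.Ioo a b) (hgap : Disjoint (Set.Ioo a b) (spectrum ℝ H))
    (φ : ℝ → ℝ) (hφ : Continuous φ) (hφ_int : ∫ x, φ x = 1)
    (hφ_compact : HasCompactSupport φ) (hφ_supp : tsupport φ ⊆ Set.Ioo a b) :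
    EdgeTrace.IsTraceClass
      (cfc φ (EdgeTrace.contraction EdgeTrace.halfY H) *
        (Complex.I • ⁅EdgeTrace.contraction EdgeTrace.halfY H,
          (EdgeTrace.chi EdgeTrace.halfW :
            EdgeTrace.LatticeSpace n →L[ℂ] EdgeTrace.LatticeSpace n)⁆)) :=
  mainTheorem4_general hH hdecay EdgeTrace.isBoundaryFunction_halfY
    EdgeTrace.isBoundaryFunction_halfW EdgeTrace.summable_inv_one_add_sq_mul_one_add_sq
    (hE.1.trans hE.2) hgap hφ hφ_supp
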